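/- Let $n\ge 0$, let $\mathbb F_q$ be a finite field with $q$ elements, and put $[[n]]=\{(i,j):1\le i<j\le n\}$. Let $\mathcal P\subset[[n]]$ be a poset (if $(i,j),(j,k)\in\mathcal P$ then $(i,k)\in\mathcal P$) that is normal in $[[n]]$: $(j,k)\in\mathcal P$ implies $(i,l)\in\mathcal P$ whenever $1\le i\le j<k\le l\le n$. For a matrix $X$ write $\operatorname{supp}(X)=\{(i,j):X_{ij}\ne0\}$. Let $U_{\mathcal P}$ be the group of $n\times n$ upper triangular matrices $g$ over $\mathbb F_q$ with ones on the diagonal such that $g_{ij}=0$ whenever $i<j$ and $(i,j)\notin\mathcal P$, and let $\mathfrak n_{\mathcal P}=U_{\mathcal P}-1$ be the algebra of strictly upper triangular matrices $X$ with $\operatorname{supp}(X)\subset\mathcal P$. The superclasses of $U_{\mathcal P}$ are the images of the two-sided $U_{\mathcal P}$-orbits in $\mathfrak n_{\mathcal P}$ under $X\mapsto 1+X$; the superclass containing $g\in U_{\mathcal P}$ is $\{1+x(g-1)y:x,y\in U_{\mathcal P}\}$. Let $\mathscr S_{\mathcal P}$ (the labeled set partitions) be the set of $\lambda\in\mathfrak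 n_{\mathcal P}$ with at most one nonzero entry in each row and in each column. For $\lambda\in\mathscr S_{\mathcal P}$ and $\mathcal Q\in\{\mathcal P,[[n]]\}$ put $$\operatorname{adj}^{\mathrm L}_{\mathcal Q}(\lambda)=\{(i,k):\exists\,(j,k)\in\operatorname{supp}(\lambda)\text{ with }(i,j)\in\mathcal Q\},\qquad \operatorname{adj}^{\mathrm R}_{\mathcal Q}(\lambda)=\{(i,k):\exists\,(i,j)\in\operatorname{supp}(\lambda)\text{ with }(j,k)\in\mathcal Q\},$$ $\operatorname{adj}_{\mathcal Q}(\lambda)=\operatorname{adj}^{\mathrm L}_{\mathcal Q}(\lambda)\cup\operatorname{adj}^{\mathrm R}_{\mathcal Q}(\lambda)$, and $\operatorname{aux}^{\bullet}_{\mathcal P}(\lambda)=\operatorname{adj}^{\bullet}_{[[n]]}(\lambda)\setminus\operatorname{adj}^{\bullet}_{\mathcal P}(\lambda)$, where $\bullet$ is $\mathrm L$, $\mathrm R$ or empty. For $X,Y\in\mathfrak n_{\mathcal P}$ define $$(X*_\lambda Y)_{il}=X_{il}+Y_{il}+\sum_{\substack{i<j<k<l\\(j,k)\in\operatorname{supp}(\lambda)}}X_{ik}Y_{jl}(\lambda_{jk})^{-1}.$$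 If $X\in\mathfrak n_{\mathcal P}$ and $\operatorname{supp}(X)\subset\operatorname{aux}_{\mathcal P}(\lambda)$, write uniquely $X=X_{\mathrm L}+X_{\mathrm R\setminus\mathrm L}$ with $\operatorname{supp}(X_{\mathrm L})\subset\operatorname{aux}^{\mathrm L}_{\mathcal P}(\lambda)$ and $\operatorname{supp}(X_{\mathrm R\setminus\mathrm L})\subset\operatorname{aux}^{\mathrm R}_{\mathcal P}(\lambda)\setminus\operatorname{aux}^{\mathrm L}_{\mathcal P}(\lambda)$, and put $\mathfrak R_\lambda(X)=X_{\mathrm L}*_\lambda X_{\mathrm R\setminus\mathrm L}$. Then $1+\lambda+\mathfrak R_\lambda(X)\in U_{\mathcal P}$ for all $\lambda\in\mathscr S_{\mathcal P}$ and $X\in\mathfrak n_{\mathcal P}$ with $\operatorname{supp}(X)\subset\operatorname{aux}_{\mathcal P}(\lambda)$; let $\mathcal K^{(\lambda,X)}_{\mathcal P}$ be the superclass of $U_{\mathcal P}$ containing it. Moreover: (a) The map $(\lambda,X)\mapsto\mathcal K^{(\lambda,X)}_{\mathcal P}$ is a bijection from $\{(\lambda,X):\lambda\in\mathscr S_{\mathcal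 P},\ X\in\mathfrak n_{\mathcal P},\ \operatorname{supp}(X)\subset\operatorname{aux}_{\mathcal P}(\lambda)\}$ onto the set of superclasses of $U_{\mathcal P}$. (b) For each such pair, $|\mathcal K^{(\lambda,X)}_{\mathcal P}|=q^{|\operatorname{adj}_{\mathcal P}(\lambda)|}$, which does not depend on $X$. -/

import Mathlib

namespace PatternGroup

variable {F : Type*} [Field F] {n : ℕ}

/-- The set `[[n]]` of all positions strictly above the diagonal. -/
def upper (n : ℕ) : Set (Fin n × Fin n) := {p | p.1 < p.2}

/-- A poset on `[n]`: a set of positions above the diagonal that is transitive. -/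
structure IsPoset (P : Set (Fin n × Fin n)) : Prop where
  subset_upper : P ⊆ upper n
  trans : ∀ i j k, (i, j) ∈ P → (j, k) ∈ P → (i, k) ∈ P

/-- `P` is normal in `[[n]]`. -/
def IsNormal (P : Set (Fin n × Fin n)) : Prop :=
  ∀ i j k l : Fin n, i ≤ j → j < k → k ≤ l → (i, l) ∉ P → (j, k) ∉ P

/-- The positions of the nonzero entries of a matrix. -/
def supp (X : Matrix (Fin n) (Fin n) F) : Set (Fin n × Fin n) := {p | X p.1 p.2 ≠ 0}

/-- The group `U_n` of upper triangular matrices with ones on the diagonal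
(as a set of matrices, under matrix multiplication). -/
def unitri (n : ℕ) (F : Type*) [Field F] : Set (Matrix (Fin n) (Fin n) F) :=
  {g | (∀ i, g i i = 1) ∧ ∀ i j, j < i → g i j = 0}

/-- The pattern group `U_P` (as a set of matrices, under matrix multiplication). -/
def patternGroup (F : Type*) [Field F] (P : Set (Fin n × Fin n)) :
    Set (Matrix (Fin n) (Fin n) F) :=
  {g | g ∈ unitri n F ∧ ∀ i j, i < j → (i, j) ∉ P → g i j = 0}

/-- The nilpotent algebra `𝔫_P` of strictly upper triangular matrices supported in `P`. -/
def patternAlgebra (F : Type*) [Field F] (P : Set (Fin n × Fin n)) :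
    Set (Matrix (Fin n) (Fin n) F) :=
  {X | (∀ i j, j ≤ i → X i j = 0) ∧ supp X ⊆ P}

/-- The two-sided `U_P`-orbit of a matrix. -/
def twoSidedOrbit (P : Set (Fin n × Fin n)) (X : Matrix (Fin n) (Fin n) F) :
    Set (Matrix (Fin n) (Fin n) F) :=
  {Y | ∃ x ∈ patternGroup F P, ∃ y ∈ patternGroup F P, Y = x * X * y}

/-- The superclasses of `U_P`: the images, under `X ↦ 1 + X`, of the two-sided `U_P`-orbits
in `𝔫_P`. -/
def superclasses (F : Type*) [Field F] (P : Set (Fin n × Fin n)) :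
    Set (Set (Matrix (Fin n) (Fin n) F)) :=
  {K | ∃ X ∈ patternAlgebra F P, K = (fun Y => 1 + Y) '' twoSidedOrbit P X}

/-- The superclass `{1 + x (g - 1) y : x, y ∈ U_P}` of `U_P` containing `g ∈ U_P`. -/
def superclassOf (P : Set (Fin n × Fin n)) (g : Matrix (Fin n) (Fin n) F) :
    Set (Matrix (Fin n) (Fin n) F) :=
  {h | ∃ x ∈ patternGroup F P, ∃ y ∈ patternGroup F P, h = 1 + x * (g - 1) * y}

/-- The set `𝒮_P` of labeled set partitions, as matrices in `𝔫_P` with at most one nonzero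
position in each row and in each column. -/
def labeledSetPartitions (F : Type*) [Field F] (P : Set (Fin n × Fin n)) :
    Set (Matrix (Fin n) (Fin n) F) :=
  {lam | lam ∈ patternAlgebra F P ∧
    (∀ i j k, (i, j) ∈ supp lam → (i, k) ∈ supp lam → j = k) ∧
    (∀ i j k, (i, k) ∈ supp lam → (j, k) ∈ supp lam → i = j)}

def adjL (Q : Set (Fin n × Fin n)) (lam : Matrix (Fin n) (Fin n) F) : Set (Fin n × Fin n) :=
  {p | ∃ j, (j, p.2) ∈ supp lam ∧ (p.1, j) ∈ Q}

def adjR (Q : Set (Fin n × Fin n)) (lam : Matrix (Fin n) (Fin n) F) : Set (Fin n × Fin n) :=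
  {p | ∃ j, (p.1, j) ∈ supp lam ∧ (j, p.2) ∈ Q}

def adj (Q : Set (Fin n × Fin n)) (lam : Matrix (Fin n) (Fin n) F) : Set (Fin n × Fin n) :=
  adjL Q lam ∪ adjR Q lam

def auxL (Q : Set (Fin n × Fin n)) (lam : Matrix (Fin n) (Fin n) F) : Set (Fin n × Fin n) :=
  adjL (upper n) lam \ adjL Q lam

def auxR (Q : Set (Fin n × Fin n)) (lam : Matrix (Fin n) (Fin n) F) : Set (Fin n × Fin n) :=
  adjR (upper n) lam \ adjR Q lam

def aux (Q : Set (Fin n × Fin n)) (lam : Matrix (Fin n) (Fin n) F) : Set (Fin n × Fin n) :=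
  adj (upper n) lam \ adj Q lam

open Classical in
/-- The product `X *_lam Y`; the sum runs over `i < j < k < l` with `(j, k) ∈ supp lam`. -/
noncomputable def starProd (lam X Y : Matrix (Fin n) (Fin n) F) : Matrix (Fin n) (Fin n) F :=
  Matrix.of fun i l => X i l + Y i l +
    ∑ j, ∑ k, if i < j ∧ j < k ∧ k < l ∧ (j, k) ∈ supp lam
      then X i k * Y j l * (lam j k)⁻¹ else 0

open Classical in
/-- The matrix that agrees with `X` at the positions in `S` and is zero elsewhere. -/
noncomputable def restrict (S : Set (Fin n × Fin n)) (X : Matrix (Fin n) (Fin n) F) :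
    Matrix (Fin n) (Fin n) F :=
  Matrix.of fun i j => if (i, j) ∈ S then X i j else 0

/-- The component `X_L` of `X`. -/
noncomputable def partL (P : Set (Fin n × Fin n)) (lam X : Matrix (Fin n) (Fin n) F) :
    Matrix (Fin n) (Fin n) F :=
  restrict (auxL P lam) X

/-- The component `X_{R \ L}` of `X`. -/
noncomputable def partRL (P : Set (Fin n × Fin n)) (lam X : Matrix (Fin n) (Fin n) F) :
    Matrix (Fin n) (Fin n) F :=
  restrict (auxR P lam \ auxL P lam) X

/-- `ℜ_lam(X) = X_L *_lam X_{R \ L}`. -/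
noncomputable def bigR (P : Set (Fin n × Fin n)) (lam X : Matrix (Fin n) (Fin n) F) :
    Matrix (Fin n) (Fin n) F :=
  starProd lam (partL P lam X) (partRL P lam X)

/-- The set of pairs `(lam, X)` with `lam ∈ 𝒮_P`, `X ∈ 𝔫_P` and `supp X ⊆ aux_P(lam)`. -/
def indexSet (F : Type*) [Field F] (P : Set (Fin n × Fin n)) :
    Set (Matrix (Fin n) (Fin n) F × Matrix (Fin n) (Fin n) F) :=
  {p | p.1 ∈ labeledSetPartitions F P ∧ p.2 ∈ patternAlgebra F P ∧ supp p.2 ⊆ aux P p.1}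

/-- The representative `1 + lam + ℜ_lam(X)`. -/
noncomputable def rep (P : Set (Fin n × Fin n)) (lam X : Matrix (Fin n) (Fin n) F) :
    Matrix (Fin n) (Fin n) F :=
  1 + lam + bigR P lam X

theorem mem_superclassOf (P : Set (Fin n × Fin n)) (g : Matrix (Fin n) (Fin n) F) :
    g ∈ superclassOf P g := by
  have h1 : (1 : Matrix (Fin n) (Fin n) F) ∈ patternGroup F P :=
    ⟨⟨fun i => by simp, fun i j h => Matrix.one_apply_ne h.ne'⟩,
      fun i j h _ => Matrix.one_apply_ne h.ne⟩
  exact ⟨1, h1, 1, h1, by simp⟩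

theorem superclassOf_eq_image (P : Set (Fin n × Fin n)) (g : Matrix (Fin n) (Fin n) F) :
    superclassOf P g = (fun Y => 1 + Y) '' twoSidedOrbit P (g - 1) := by
  ext h
  constructor
  · rintro ⟨x, hx, y, hy, rfl⟩
    exact ⟨_, ⟨x, hx, y, hy, rfl⟩, rfl⟩
  · rintro ⟨_, ⟨x, hx, y, hy, rfl⟩, rfl⟩
    exact ⟨x, hx, y, hy, rfl⟩

/-- `(X_L, X_{R \ L})` is the unique pair with sum `X` and with the prescribed supports. -/
theorem part_unique (P : Set (Fin n × Fin n)) (lam X : Matrix (Fin n) (Fin n) F)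
    (hX : supp X ⊆ aux P lam) (A B : Matrix (Fin n) (Fin n) F) :
    (X = A + B ∧ supp A ⊆ auxL P lam ∧ supp B ⊆ auxR P lam \ auxL P lam) ↔
      A = partL P lam X ∧ B = partRL P lam X := by
  have hsub : aux P lam ⊆ auxL P lam ∪ auxR P lam := by
    rintro p ⟨h1 | h1, h2⟩
    · exact Or.inl ⟨h1, fun h => h2 (Or.inl h)⟩
    · exact Or.inr ⟨h1, fun h => h2 (Or.inr h)⟩
  constructor
  · rintro ⟨rfl, hA, hB⟩
    have a0 : ∀ i j, (i, j) ∉ auxL P lam → A i j = 0 := fun i j h => by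
      by_contra h'
      exact h (hA h')
    have b0 : ∀ i j, (i, j) ∉ auxR P lam \ auxL P lam → B i j = 0 := fun i j h => by
      by_contra h'
      exact h (hB h')
    constructor
    · ext i j
      by_cases h : (i, j) ∈ auxL P lam
      · simp [partL, restrict, h, b0 i j (fun h' => h'.2 h)]
      · simp [partL, restrict, h, a0 i j h]
    · ext i j
      by_cases h : (i, j) ∈ auxR P lam \ auxL P lam
      · simp only [partRL, restrict, Matrix.of_apply, if_pos h, Matrix.add_apply, a0 i j h.2,
          zero_add]
      · simp only [partRL, restrict, Matrix.of_apply, if_neg h, b0 i j h]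
  · rintro ⟨rfl, rfl⟩
    refine ⟨?_, ?_, ?_⟩
    · ext i j
      by_cases h : (i, j) ∈ auxL P lam
      · simp [partL, partRL, restrict, h]
      · by_cases h' : (i, j) ∈ auxR P lam
        · simp [partL, partRL, restrict, h, h']
        · have : X i j = 0 := by
            by_contra h0
            rcases hsub (hX (show (i, j) ∈ supp X from h0)) with h1 | h1
            · exact h h1
            · exact h' h1
          simp [partL, partRL, restrict, this]
    · rintro ⟨i, j⟩ h
      by_contra h'
      exact h (by simp [partL, restrict, h'])
    · rintro ⟨i, j⟩ h
      by_contra h'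
      exact h (by simp only [partRL, restrict, Matrix.of_apply, if_neg h'])

end PatternGroup

namespace PatternGroup

variable {F : Type*} [Field F] {n : ℕ} {P Q : Set (Fin n × Fin n)}
  {lam : Matrix (Fin n) (Fin n) F}

/-! Normality says that the pattern algebra is stable under multiplication by upper triangular
matrices on both sides. Hence `U_P` is normal in the full unitriangular group `U_n`, and the
`U_P`-orbits inside one `U_n`-orbit are translates `x * O * y` of each other
(`twoSidedOrbit_mul_mul`), in particular equinumerous. Gaussian elimination shows that each
`U_n`-orbit in the algebra contains exactly one `lam ∈ 𝒮_P` (`exists_mem_labeledSetPartitions`,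
`eq_of_mul_eq_mul`).

It remains to split the `U_n`-orbit of `lam` into `U_P`-orbits. If `x * lam = lam + A` and `lam * y
= lam + B`, then `x * lam * y = lam + A *_lam B` (`add_starProd_eq`). Adjusting `(x, y)` by the
stabilizer of `lam` and by `U_P` brings `A` and `B` to the shape `X_L`, `X_{R \ L}`, so every
`U_P`-orbit contains some `lam + ℜ_lam(X)` (`exists_mem_twoSidedOrbit_add_bigR`).

Distinct `X` give distinct orbits by counting. The orbit of `lam` under `U_Q` has `q ^ |adj_Q lam|`
elements for `Q = P` and for `Q = [[n]]` (`ncard_twoSidedOrbit`), so there are `q ^ |aux_P lam|`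
orbits, as many as there are matrices `X`. -/

/-! ### Pattern algebras as ideals, pattern groups as normal subgroups -/

theorem IsNormal.mem_of_le (hn : IsNormal P) {i j k l : Fin n} (h : (j, k) ∈ P) (hij : i ≤ j)
    (hjk : j < k) (hkl : k ≤ l) : (i, l) ∈ P := by
  by_contra h'
  exact hn i j k l hij hjk hkl h' h

theorem isPoset_upper (n : ℕ) : IsPoset (upper n) :=
  ⟨subset_rfl, fun _ _ _ h h' => lt_trans (α := Fin n) h h'⟩

theorem isNormal_upper (n : ℕ) : IsNormal (upper n) :=
  fun _ _ _ _ hij hjk hkl h _ => h (lt_of_le_of_lt hij (lt_of_lt_of_le hjk hkl))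

theorem mem_patternAlgebra (hP : IsPoset P) {X : Matrix (Fin n) (Fin n) F} :
    X ∈ patternAlgebra F P ↔ ∀ i j, X i j ≠ 0 → (i, j) ∈ P := by
  constructor
  · exact fun h i j hX => h.2 hX
  · refine fun h => ⟨fun i j hij => ?_, fun p hp => h p.1 p.2 hp⟩
    by_contra hX
    exact absurd (hP.subset_upper (h i j hX)) (not_lt.2 hij)

theorem add_mem_patternAlgebra (hP : IsPoset P) {X Y : Matrix (Fin n) (Fin n) F}
    (hX : X ∈ patternAlgebra F P) (hY : Y ∈ patternAlgebra F P) :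
    X + Y ∈ patternAlgebra F P := by
  rw [mem_patternAlgebra hP] at *
  intro i j h
  by_cases h0 : X i j = 0
  · exact hY i j fun h1 => h (by simp [h0, h1])
  · exact hX i j h0

theorem neg_mem_patternAlgebra (hP : IsPoset P) {X : Matrix (Fin n) (Fin n) F}
    (hX : X ∈ patternAlgebra F P) : -X ∈ patternAlgebra F P := by
  rw [mem_patternAlgebra hP] at *
  exact fun i j h => hX i j fun h1 => h (by simp [h1])

/-- This is where normality enters: in a nonzero term `U i j * X j k` one has `i ≤ j` and `(j, k) ∈
P`, which forces `(i, k) ∈ P`. -/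
theorem mul_mem_patternAlgebra_left (hP : IsPoset P) (hn : IsNormal P)
    {U X : Matrix (Fin n) (Fin n) F} (hU : U.BlockTriangular id)
    (hX : X ∈ patternAlgebra F P) : U * X ∈ patternAlgebra F P := by
  rw [mem_patternAlgebra hP] at *
  intro i k h
  rw [Matrix.mul_apply] at h
  obtain ⟨j, -, hj⟩ := Finset.exists_ne_zero_of_sum_ne_zero h
  have h1 := hX j k (right_ne_zero_of_mul hj)
  exact hn.mem_of_le h1 (not_lt.1 fun h2 => left_ne_zero_of_mul hj (hU h2))
    (hP.subset_upper h1) le_rfl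

theorem mul_mem_patternAlgebra_right (hP : IsPoset P) (hn : IsNormal P)
    {U X : Matrix (Fin n) (Fin n) F} (hX : X ∈ patternAlgebra F P)
    (hU : U.BlockTriangular id) : X * U ∈ patternAlgebra F P := by
  rw [mem_patternAlgebra hP] at *
  intro i k h
  rw [Matrix.mul_apply] at h
  obtain ⟨j, -, hj⟩ := Finset.exists_ne_zero_of_sum_ne_zero h
  have h1 := hX i j (left_ne_zero_of_mul hj)
  exact hn.mem_of_le h1 le_rfl (hP.subset_upper h1)
    (not_lt.1 fun h2 => right_ne_zero_of_mul hj (hU h2))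

theorem mem_patternGroup (hP : IsPoset P) {g : Matrix (Fin n) (Fin n) F} :
    g ∈ patternGroup F P ↔ g - 1 ∈ patternAlgebra F P := by
  rw [mem_patternAlgebra hP]
  constructor
  · rintro ⟨⟨h1, h2⟩, h3⟩ i j h
    rcases lt_trichotomy i j with hij | rfl | hij
    · by_contra h4
      exact h (by simp [h3 i j hij h4, hij.ne])
    · exact absurd (by simp [h1]) h
    · exact absurd (by simp [h2 i j hij, hij.ne']) h
  · have key (h : ∀ i j, (g - 1) i j ≠ 0 → (i, j) ∈ P) (i j) (hij : (i, j) ∉ P) :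
        g i j = (1 : Matrix (Fin n) (Fin n) F) i j := by
      by_contra h4
      exact hij (h i j (sub_ne_zero.2 h4))
    refine fun h => ⟨⟨fun i => ?_, fun i j hij => ?_⟩, fun i j hij hP' => ?_⟩
    · rw [key h i i fun h' => lt_irrefl i (hP.subset_upper h'), Matrix.one_apply_eq]
    · rw [key h i j fun h' => lt_asymm hij (hP.subset_upper h'), Matrix.one_apply_ne hij.ne']
    · rw [key h i j hP', Matrix.one_apply_ne hij.ne]

theorem one_add_mem_patternGroup (hP : IsPoset P) {X : Matrix (Fin n) (Fin n) F}
    (hX : X ∈ patternAlgebra F P) : 1 + X ∈ patternGroup F P := by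
  rw [mem_patternGroup hP]
  simpa using hX

theorem one_mem_patternGroup (hP : IsPoset P) :
    (1 : Matrix (Fin n) (Fin n) F) ∈ patternGroup F P := by
  rw [mem_patternGroup hP, mem_patternAlgebra hP]
  simp

theorem patternGroup_subset_upper : patternGroup F P ⊆ patternGroup F (upper n) :=
  fun _ hg => ⟨hg.1, fun _ _ hij h => absurd hij h⟩

theorem patternAlgebra_subset_upper : patternAlgebra F P ⊆ patternAlgebra F (upper n) :=
  fun _ hX => ⟨hX.1, fun p hp => not_le.1 fun h => hp (hX.1 p.1 p.2 h)⟩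

theorem blockTriangular_of_mem_patternGroup {g : Matrix (Fin n) (Fin n) F}
    (hg : g ∈ patternGroup F P) : g.BlockTriangular id :=
  fun i j h => hg.1.2 i j h

theorem isUnit_det_of_mem_patternGroup {g : Matrix (Fin n) (Fin n) F}
    (hg : g ∈ patternGroup F P) : IsUnit g.det := by
  rw [Matrix.det_of_isUpperTriangular (blockTriangular_of_mem_patternGroup hg)]
  simp [hg.1.1]

theorem inv_mul_of_mem_patternGroup {g : Matrix (Fin n) (Fin n) F}
    (hg : g ∈ patternGroup F P) : g⁻¹ * g = 1 :=
  Matrix.nonsing_inv_mul g (isUnit_det_of_mem_patternGroup hg)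

theorem mul_inv_of_mem_patternGroup {g : Matrix (Fin n) (Fin n) F}
    (hg : g ∈ patternGroup F P) : g * g⁻¹ = 1 :=
  Matrix.mul_nonsing_inv g (isUnit_det_of_mem_patternGroup hg)

theorem blockTriangular_inv_of_mem_patternGroup {g : Matrix (Fin n) (Fin n) F}
    (hg : g ∈ patternGroup F P) : g⁻¹.BlockTriangular id := by
  have := Matrix.invertibleOfIsUnitDet g (isUnit_det_of_mem_patternGroup hg)
  exact Matrix.blockTriangular_inv_of_blockTriangular (blockTriangular_of_mem_patternGroup hg)

/-- Since `g⁻¹ - 1 = -g⁻¹ * (g - 1)`, the ideal property suffices once `g⁻¹` is known to be upper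
triangular. -/
theorem inv_mem_patternGroup (hP : IsPoset P) (hn : IsNormal P) {g : Matrix (Fin n) (Fin n) F}
    (hg : g ∈ patternGroup F P) : g⁻¹ ∈ patternGroup F P := by
  rw [mem_patternGroup hP]
  have h : g⁻¹ - 1 = -(g⁻¹ * (g - 1)) := by
    rw [mul_sub, inv_mul_of_mem_patternGroup hg, mul_one, neg_sub]
  rw [h]
  exact neg_mem_patternAlgebra hP (mul_mem_patternAlgebra_left hP hn
    (blockTriangular_inv_of_mem_patternGroup hg) ((mem_patternGroup hP).1 hg))

theorem mul_mem_patternGroup (hP : IsPoset P) (hn : IsNormal P)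
    {g h : Matrix (Fin n) (Fin n) F} (hg : g ∈ patternGroup F P) (hh : h ∈ patternGroup F P) :
    g * h ∈ patternGroup F P := by
  rw [mem_patternGroup hP]
  have : g * h - 1 = (g - 1) * h + (h - 1) := by noncomm_ring
  rw [this]
  exact add_mem_patternAlgebra hP (mul_mem_patternAlgebra_right hP hn
    ((mem_patternGroup hP).1 hg) (blockTriangular_of_mem_patternGroup hh))
    ((mem_patternGroup hP).1 hh)

/-- `U_P` is normalized by `U_n`. -/
theorem conj_mem_patternGroup (hP : IsPoset P) (hn : IsNormal P)
    {x g : Matrix (Fin n) (Fin n) F} (hx : x ∈ patternGroup F (upper n))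
    (hg : g ∈ patternGroup F P) : x * g * x⁻¹ ∈ patternGroup F P := by
  rw [mem_patternGroup hP]
  have : x * g * x⁻¹ - 1 = x * (g - 1) * x⁻¹ := by
    rw [mul_sub, sub_mul, mul_one, mul_inv_of_mem_patternGroup hx]
  rw [this]
  exact mul_mem_patternAlgebra_right hP hn (mul_mem_patternAlgebra_left hP hn
    (blockTriangular_of_mem_patternGroup hx) ((mem_patternGroup hP).1 hg))
    (blockTriangular_inv_of_mem_patternGroup hx)

theorem conj_mem_patternGroup' (hP : IsPoset P) (hn : IsNormal P)
    {x g : Matrix (Fin n) (Fin n) F} (hx : x ∈ patternGroup F (upper n))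
    (hg : g ∈ patternGroup F P) : x⁻¹ * g * x ∈ patternGroup F P := by
  have := conj_mem_patternGroup hP hn
    (inv_mem_patternGroup (isPoset_upper n) (isNormal_upper n) hx) hg
  rwa [Matrix.nonsing_inv_nonsing_inv _ (isUnit_det_of_mem_patternGroup hx)] at this

/-! ### Two-sided orbits -/

theorem mem_twoSidedOrbit_self (hP : IsPoset P) (X : Matrix (Fin n) (Fin n) F) :
    X ∈ twoSidedOrbit P X :=
  ⟨1, one_mem_patternGroup hP, 1, one_mem_patternGroup hP, by simp⟩

theorem twoSidedOrbit_eq_of_mem (hP : IsPoset P) (hn : IsNormal P)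
    {X Y : Matrix (Fin n) (Fin n) F} (h : Y ∈ twoSidedOrbit P X) :
    twoSidedOrbit P Y = twoSidedOrbit P X := by
  obtain ⟨x, hx, y, hy, rfl⟩ := h
  ext Z
  constructor
  · rintro ⟨u, hu, v, hv, rfl⟩
    exact ⟨u * x, mul_mem_patternGroup hP hn hu hx, y * v, mul_mem_patternGroup hP hn hy hv,
      by simp only [mul_assoc]⟩
  · rintro ⟨u, hu, v, hv, rfl⟩
    refine ⟨u * x⁻¹, mul_mem_patternGroup hP hn hu (inv_mem_patternGroup hP hn hx), y⁻¹ * v,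
      mul_mem_patternGroup hP hn (inv_mem_patternGroup hP hn hy) hv, ?_⟩
    have h1 := inv_mul_of_mem_patternGroup hx
    have h2 := mul_inv_of_mem_patternGroup hy
    calc u * X * v = u * (x⁻¹ * x) * X * (y * y⁻¹) * v := by rw [h1, h2]; simp
      _ = _ := by simp only [mul_assoc]

/-- The `U_P`-orbits in a `U_n`-orbit are translates of one another. -/
theorem twoSidedOrbit_mul_mul (hP : IsPoset P) (hn : IsNormal P)
    {x y : Matrix (Fin n) (Fin n) F} (hx : x ∈ patternGroup F (upper n))
    (hy : y ∈ patternGroup F (upper n)) (X : Matrix (Fin n) (Fin n) F) :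
    twoSidedOrbit P (x * X * y) = (fun Y => x * Y * y) '' twoSidedOrbit P X := by
  have h1 := mul_inv_of_mem_patternGroup hx
  have h2 := inv_mul_of_mem_patternGroup hy
  have h3 := inv_mul_of_mem_patternGroup hx
  have h4 := mul_inv_of_mem_patternGroup hy
  ext Z
  constructor
  · rintro ⟨u, hu, v, hv, rfl⟩
    refine ⟨_, ⟨_, conj_mem_patternGroup' hP hn hx hu, _, conj_mem_patternGroup hP hn hy hv,
      rfl⟩, ?_⟩
    calc _ = (x * x⁻¹) * u * x * X * y * v * (y⁻¹ * y) := by simp only [mul_assoc]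
      _ = _ := by rw [h1, h2]; simp only [mul_assoc, mul_one, one_mul]
  · rintro ⟨_, ⟨u, hu, v, hv, rfl⟩, rfl⟩
    refine ⟨_, conj_mem_patternGroup hP hn hx hu, _, conj_mem_patternGroup' hP hn hy hv, ?_⟩
    calc _ = x * u * (x⁻¹ * x) * X * (y * y⁻¹) * v * y := by
          rw [h3, h4]; simp only [mul_assoc, one_mul]
      _ = _ := by simp only [mul_assoc]

/-! ### One-sided multiples of a labeled set partition -/

theorem mem_adjL_of_mul_ne_zero (hQ : IsPoset Q) {N : Matrix (Fin n) (Fin n) F}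
    (hN : N ∈ patternAlgebra F Q) {i k : Fin n} (h : (N * lam) i k ≠ 0) :
    (i, k) ∈ adjL Q lam := by
  rw [Matrix.mul_apply] at h
  obtain ⟨j, -, hj⟩ := Finset.exists_ne_zero_of_sum_ne_zero h
  exact ⟨j, right_ne_zero_of_mul hj, (mem_patternAlgebra hQ).1 hN i j (left_ne_zero_of_mul hj)⟩

theorem mem_adjR_of_mul_ne_zero (hQ : IsPoset Q) {N : Matrix (Fin n) (Fin n) F}
    (hN : N ∈ patternAlgebra F Q) {i k : Fin n} (h : (lam * N) i k ≠ 0) :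
    (i, k) ∈ adjR Q lam := by
  rw [Matrix.mul_apply] at h
  obtain ⟨j, -, hj⟩ := Finset.exists_ne_zero_of_sum_ne_zero h
  exact ⟨j, left_ne_zero_of_mul hj, (mem_patternAlgebra hQ).1 hN j k (right_ne_zero_of_mul hj)⟩

theorem mul_apply_of_mem_supp (hlam : lam ∈ labeledSetPartitions F P)
    (N : Matrix (Fin n) (Fin n) F) {j k : Fin n} (h : lam j k ≠ 0) (i : Fin n) :
    (N * lam) i k = N i j * lam j k := by
  rw [Matrix.mul_apply]
  refine Finset.sum_eq_single j (fun j' _ hj' => ?_) (by simp)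
  by_contra h0
  exact hj' (hlam.2.2 j' j k (right_ne_zero_of_mul h0) h)

theorem apply_mul_of_mem_supp (hlam : lam ∈ labeledSetPartitions F P)
    (N : Matrix (Fin n) (Fin n) F) {i j : Fin n} (h : lam i j ≠ 0) (k : Fin n) :
    (lam * N) i k = lam i j * N j k := by
  rw [Matrix.mul_apply]
  refine Finset.sum_eq_single j (fun j' _ hj' => ?_) (by simp)
  by_contra h0
  exact hj' (hlam.2.1 i j' j (left_ne_zero_of_mul h0) h)

/-- Right multiplication by `lam` moves column `j` to column `k` and rescales it for each `(j, k) ∈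
supp lam`, and this can be undone on matrices living in the columns that `lam` meets. -/
theorem exists_mul_eq_of_supp_subset_adjL (hlam : lam ∈ labeledSetPartitions F P)
    (hQ : IsPoset Q) {Z : Matrix (Fin n) (Fin n) F}
    (hZ : ∀ i k, Z i k ≠ 0 → (i, k) ∈ adjL Q lam) :
    ∃ N ∈ patternAlgebra F Q, N * lam = Z := by
  -- As `0⁻¹ = 0`, only the column `k` of the nonzero entry in row `j` of `lam`, if there is one,
  -- contributes.
  refine ⟨Matrix.of fun i j => ∑ k, Z i k * (lam j k)⁻¹, ?_, ?_⟩
  · rw [mem_patternAlgebra hQ]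
    intro i j h
    rw [Matrix.of_apply] at h
    obtain ⟨k, -, hk⟩ := Finset.exists_ne_zero_of_sum_ne_zero h
    obtain ⟨j', hj', hij'⟩ := hZ i k (left_ne_zero_of_mul hk)
    have h1 : lam j k ≠ 0 := inv_eq_zero.not.1 (right_ne_zero_of_mul hk)
    rwa [hlam.2.2 j j' k h1 hj']
  · ext i k
    by_cases h : ∃ j, lam j k ≠ 0
    · obtain ⟨j, hj⟩ := h
      rw [mul_apply_of_mem_supp hlam _ hj, Matrix.of_apply, Finset.sum_eq_single k, mul_assoc,
        inv_mul_cancel₀ hj, mul_one]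
      · intro k' _ hk'
        by_contra h0
        exact hk' (hlam.2.1 j k' k (inv_eq_zero.not.1 (right_ne_zero_of_mul h0)) hj)
      · simp
    · push Not at h
      have : Z i k = 0 := by
        by_contra h0
        obtain ⟨j, hj, -⟩ := hZ i k h0
        exact hj (h j)
      simp [Matrix.mul_apply, h, this]

theorem exists_mul_eq_of_supp_subset_adjR (hlam : lam ∈ labeledSetPartitions F P)
    (hQ : IsPoset Q) {Z : Matrix (Fin n) (Fin n) F}
    (hZ : ∀ i k, Z i k ≠ 0 → (i, k) ∈ adjR Q lam) :
    ∃ N ∈ patternAlgebra F Q, lam * N = Z := by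
  refine ⟨Matrix.of fun j k => ∑ i, (lam i j)⁻¹ * Z i k, ?_, ?_⟩
  · rw [mem_patternAlgebra hQ]
    intro j k h
    rw [Matrix.of_apply] at h
    obtain ⟨i, -, hi⟩ := Finset.exists_ne_zero_of_sum_ne_zero h
    obtain ⟨j', hj', hij'⟩ := hZ i k (right_ne_zero_of_mul hi)
    have h1 : lam i j ≠ 0 := inv_eq_zero.not.1 (left_ne_zero_of_mul hi)
    rwa [hlam.2.1 i j j' h1 hj']
  · ext i k
    by_cases h : ∃ j, lam i j ≠ 0
    · obtain ⟨j, hj⟩ := h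
      rw [apply_mul_of_mem_supp hlam _ hj, Matrix.of_apply, Finset.sum_eq_single i, ← mul_assoc,
        mul_inv_cancel₀ hj, one_mul]
      · intro i' _ hi'
        by_contra h0
        exact hi' (hlam.2.2 i' i j (inv_eq_zero.not.1 (left_ne_zero_of_mul h0)) hj)
      · simp
    · push Not at h
      have : Z i k = 0 := by
        by_contra h0
        obtain ⟨j, hj, -⟩ := hZ i k h0
        exact hj (h j)
      simp [Matrix.mul_apply, h, this]

/-- If `x * lam = lam + A` and `lam * y = lam + B` then `lam + A *_lam B = x * lam * y`. -/
theorem add_starProd_eq (hlam : lam ∈ labeledSetPartitions F P)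
    {x y A B : Matrix (Fin n) (Fin n) F} (hx : x ∈ patternGroup F (upper n))
    (hy : y ∈ patternGroup F (upper n)) (hA : x * lam = lam + A) (hB : lam * y = lam + B) :
    lam + starProd lam A B = x * lam * y := by
  obtain ⟨a, rfl⟩ : ∃ a, x = 1 + a := ⟨x - 1, by simp⟩
  obtain ⟨b, rfl⟩ : ∃ b, y = 1 + b := ⟨y - 1, by simp⟩
  rw [mem_patternGroup (isPoset_upper n), add_sub_cancel_left,
    mem_patternAlgebra (isPoset_upper n)] at hx hy
  obtain rfl : A = a * lam := by simpa [add_mul] using hA.symm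
  obtain rfl : B = lam * b := by simpa [mul_add] using hB.symm
  -- For `(j, k) ∈ supp lam` the factors are `a i j * lam j k` and `lam j k * b k l`, so the inverse
  -- in the star product cancels one copy of `lam j k`. The condition `i < j < k < l` is automatic
  -- for nonzero terms.
  have key : starProd lam (a * lam) (lam * b) = a * lam + lam * b + a * lam * b := by
    ext i l
    have e : (a * lam * b) i l = ∑ k, ∑ j, a i j * lam j k * b k l := by
      simp only [Matrix.mul_apply, Finset.sum_mul]
    simp only [starProd, Matrix.of_apply, Matrix.add_apply, add_right_inj]
    rw [Finset.sum_comm, e]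
    refine Finset.sum_congr rfl fun k _ => Finset.sum_congr rfl fun j _ => ?_
    by_cases hjk : lam j k = 0
    · rw [if_neg (by simp [supp, hjk]), hjk, mul_zero, zero_mul]
    · by_cases haj : a i j = 0
      · rw [mul_apply_of_mem_supp hlam _ hjk, haj]
        simp
      by_cases hbk : b k l = 0
      · rw [apply_mul_of_mem_supp hlam _ hjk, hbk]
        simp
      rw [if_pos ⟨hx i j haj, not_le.1 fun h => hjk (hlam.1.1 j k h), hy k l hbk, hjk⟩,
        mul_apply_of_mem_supp hlam _ hjk, apply_mul_of_mem_supp hlam _ hjk]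
      field_simp
  rw [key]
  noncomm_ring

/-! ### Uniqueness of the labeled set partition in a `U_n`-orbit -/

/-- Two labeled set partitions in the same two-sided `U_n`-orbit are equal. -/
theorem eq_of_mul_eq_mul {mu x y : Matrix (Fin n) (Fin n) F}
    (hlam : lam ∈ labeledSetPartitions F P) (hmu : mu ∈ labeledSetPartitions F P)
    (hx : x ∈ patternGroup F (upper n)) (hy : y ∈ patternGroup F (upper n))
    (h : lam * y = x * mu) : lam = mu := by
  have hcol (i k : Fin n) (h0 : ∀ j, j < k → lam i j = 0) : (lam * y) i k = lam i k := by
    rw [Matrix.mul_apply, Finset.sum_eq_single k, hy.1.1, mul_one]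
    · intro j _ hj
      rcases lt_or_gt_of_ne hj with hjk | hjk
      · rw [h0 j hjk, zero_mul]
      · rw [hy.1.2 j k hjk, mul_zero]
    · simp
  have hrow (i k : Fin n) (h0 : ∀ j, i < j → mu j k = 0) : (x * mu) i k = mu i k := by
    rw [Matrix.mul_apply, Finset.sum_eq_single i, hx.1.1, one_mul]
    · intro j _ hj
      rcases lt_or_gt_of_ne hj with hjk | hjk
      · rw [hx.1.2 i j hjk, zero_mul]
      · rw [h0 j hjk, mul_zero]
    · simp
  -- The induction starts at the bottom left corner. An entry of `lam` to the left in row `i`, or of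
  -- `mu` below in column `k`, is already shared by both and forces zeros at `(i, k)`; with neither
  -- present, `lam * y` and `x * mu` show the original entries there.
  have main (m : ℕ) : ∀ i k : Fin n, (n - i) + k < m → lam i k = mu i k := by
    induction m with
    | zero => intro i k h; omega
    | succ m ih =>
      intro i k him
      by_cases h1 : ∃ j, j < k ∧ lam i j ≠ 0
      · obtain ⟨j, hjk, hj⟩ := h1
        have e : lam i j = mu i j := ih i j (by omega)
        have h2 : lam i k = 0 := by
          by_contra h3
          exact hjk.ne (hlam.2.1 i j k hj h3)
        have h4 : mu i k = 0 := by
          by_contra h3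
          exact hjk.ne (hmu.2.1 i j k (show mu i j ≠ 0 from e ▸ hj) h3)
        rw [h2, h4]
      by_cases h1' : ∃ j, i < j ∧ mu j k ≠ 0
      · obtain ⟨j, hij, hj⟩ := h1'
        have e : lam j k = mu j k := ih j k (by omega)
        have h2 : mu i k = 0 := by
          by_contra h3
          exact hij.ne (hmu.2.2 i j k h3 hj)
        have h4 : lam i k = 0 := by
          by_contra h3
          exact hij.ne (hlam.2.2 i j k h3 (show lam j k ≠ 0 from e ▸ hj))
        rw [h2, h4]
      push Not at h1 h1'
      rw [← hcol i k h1, ← hrow i k h1', h]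
  ext i k
  exact main _ i k (Nat.lt_succ_self _)

/-! ### Representatives of the `U_P`-orbits in a `U_n`-orbit -/

-- On `S` this is a linear system for the entries of `Z` that is unitriangular in the order of the
-- columns, hence solvable.
open Classical in
theorem exists_add_mul_eq_zero_on (S : Set (Fin n × Fin n)) {y : Matrix (Fin n) (Fin n) F}
    (hy : y ∈ patternGroup F (upper n)) (Z₀ : Matrix (Fin n) (Fin n) F) :
    ∃ Z : Matrix (Fin n) (Fin n) F, (∀ i k, Z i k ≠ 0 → (i, k) ∈ S) ∧
      ∀ i k, (i, k) ∈ S → (Z₀ + Z * y) i k = 0 := by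
  -- Being the identity off `S`, `T` forces the preimage of a matrix supported on `S` to be
  -- supported on `S`.
  let T : Matrix (Fin n) (Fin n) F →ₗ[F] Matrix (Fin n) (Fin n) F :=
    { toFun := fun Z => Matrix.of fun i k => if (i, k) ∈ S then (Z * y) i k else Z i k
      map_add' := fun A B => by
        ext i k
        simp only [Matrix.of_apply, Matrix.add_apply, add_mul]
        split_ifs <;> rfl
      map_smul' := fun c A => by
        ext i k
        simp only [Matrix.of_apply, Matrix.smul_apply, Matrix.smul_mul, RingHom.id_apply]
        split_ifs <;> rfl }
  have hT (Z i k) : T Z i k = if (i, k) ∈ S then (Z * y) i k else Z i k := rfl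
  have hinj : Function.Injective T := by
    rw [injective_iff_map_eq_zero]
    intro Z hZ
    have main (m : ℕ) : ∀ i k : Fin n, (k : ℕ) < m → Z i k = 0 := by
      induction m with
      | zero => intro i k h; omega
      | succ m ih =>
        intro i k hk
        have h := congrFun (congrFun hZ i) k
        rw [hT, Matrix.zero_apply] at h
        split_ifs at h with hS
        · rw [Matrix.mul_apply, Finset.sum_eq_single k, hy.1.1, mul_one] at h
          · exact h
          · intro j _ hj
            rcases lt_or_gt_of_ne hj with hjk | hjk
            · rw [ih i j (by omega), zero_mul]
            · rw [hy.1.2 j k hjk, mul_zero]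
          · simp
        · exact h
    ext i k
    exact main _ i k (Nat.lt_succ_self _)
  obtain ⟨Z, hZ⟩ := LinearMap.injective_iff_surjective.1 hinj
    (Matrix.of fun i k => if (i, k) ∈ S then -Z₀ i k else 0)
  refine ⟨Z, fun i k h => ?_, fun i k h => ?_⟩
  · by_contra hS
    have h1 := congrFun (congrFun hZ i) k
    rw [hT, Matrix.of_apply, if_neg hS, if_neg hS] at h1
    exact h h1
  · have h1 := congrFun (congrFun hZ i) k
    rw [hT, Matrix.of_apply, if_pos h, if_pos h] at h1
    rw [Matrix.add_apply, h1, add_neg_cancel]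

-- Here the system is unitriangular in the order of the rows, from the bottom up.
open Classical in
theorem exists_add_mul_eq_zero_on' (S : Set (Fin n × Fin n)) {x : Matrix (Fin n) (Fin n) F}
    (hx : x ∈ patternGroup F (upper n)) (Z₀ : Matrix (Fin n) (Fin n) F) :
    ∃ Z : Matrix (Fin n) (Fin n) F, (∀ i k, Z i k ≠ 0 → (i, k) ∈ S) ∧
      ∀ i k, (i, k) ∈ S → (Z₀ + x * Z) i k = 0 := by
  let T : Matrix (Fin n) (Fin n) F →ₗ[F] Matrix (Fin n) (Fin n) F :=
    { toFun := fun Z => Matrix.of fun i k => if (i, k) ∈ S then (x * Z) i k else Z i k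
      map_add' := fun A B => by
        ext i k
        simp only [Matrix.of_apply, Matrix.add_apply, mul_add]
        split_ifs <;> rfl
      map_smul' := fun c A => by
        ext i k
        simp only [Matrix.of_apply, Matrix.smul_apply, Matrix.mul_smul, RingHom.id_apply]
        split_ifs <;> rfl }
  have hT (Z i k) : T Z i k = if (i, k) ∈ S then (x * Z) i k else Z i k := rfl
  have hinj : Function.Injective T := by
    rw [injective_iff_map_eq_zero]
    intro Z hZ
    have main (m : ℕ) : ∀ i k : Fin n, n - (i : ℕ) < m → Z i k = 0 := by
      induction m with
      | zero => intro i k h; omega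
      | succ m ih =>
        intro i k hk
        have h := congrFun (congrFun hZ i) k
        rw [hT, Matrix.zero_apply] at h
        split_ifs at h with hS
        · rw [Matrix.mul_apply, Finset.sum_eq_single i, hx.1.1, one_mul] at h
          · exact h
          · intro j _ hj
            rcases lt_or_gt_of_ne hj with hjk | hjk
            · rw [hx.1.2 i j hjk, zero_mul]
            · rw [ih j k (by omega), mul_zero]
          · simp
        · exact h
    ext i k
    exact main _ i k (Nat.lt_succ_self _)
  obtain ⟨Z, hZ⟩ := LinearMap.injective_iff_surjective.1 hinj
    (Matrix.of fun i k => if (i, k) ∈ S then -Z₀ i k else 0)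
  refine ⟨Z, fun i k h => ?_, fun i k h => ?_⟩
  · by_contra hS
    have h1 := congrFun (congrFun hZ i) k
    rw [hT, Matrix.of_apply, if_neg hS, if_neg hS] at h1
    exact h h1
  · have h1 := congrFun (congrFun hZ i) k
    rw [hT, Matrix.of_apply, if_pos h, if_pos h] at h1
    rw [Matrix.add_apply, h1, add_neg_cancel]

theorem adjL_subset_upper (hP : IsPoset P) : adjL P lam ⊆ adjL (upper n) lam :=
  fun _ ⟨j, h1, h2⟩ => ⟨j, h1, hP.subset_upper h2⟩

theorem adjR_subset_upper (hP : IsPoset P) : adjR P lam ⊆ adjR (upper n) lam :=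
  fun _ ⟨j, h1, h2⟩ => ⟨j, h1, hP.subset_upper h2⟩

theorem adj_upper_subset (hP : IsPoset P) (hn : IsNormal P)
    (hlam : lam ∈ labeledSetPartitions F P) : adj (upper n) lam ⊆ P := by
  rintro ⟨i, k⟩ (⟨j, h1, h2⟩ | ⟨j, h1, h2⟩)
  · have h3 := (mem_patternAlgebra hP).1 hlam.1 j k h1
    exact hn.mem_of_le h3 (le_of_lt h2) (hP.subset_upper h3) le_rfl
  · have h3 := (mem_patternAlgebra hP).1 hlam.1 i j h1
    exact hn.mem_of_le h3 le_rfl (hP.subset_upper h3) (le_of_lt h2)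

/-- Elements of the stabilizer of `lam` make `lam * y - lam` vanish on
`adjL (upper n) lam ∩ adjR (upper n) lam`. -/
theorem exists_mul_mul_eq_vanish_right (hlam : lam ∈ labeledSetPartitions F P)
    {x y : Matrix (Fin n) (Fin n) F} (hx : x ∈ patternGroup F (upper n))
    (hy : y ∈ patternGroup F (upper n)) :
    ∃ x' ∈ patternGroup F (upper n), ∃ y' ∈ patternGroup F (upper n),
      x' * lam * y' = x * lam * y ∧
      ∀ i k, (i, k) ∈ adjL (upper n) lam → (i, k) ∈ adjR (upper n) lam →
        (lam * y' - lam) i k = 0 := by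
  have hU := isPoset_upper n
  have hUn := isNormal_upper n
  obtain ⟨Z, hZ, hZ'⟩ := exists_add_mul_eq_zero_on
    (adjL (upper n) lam ∩ adjR (upper n) lam) hy (lam * y - lam)
  -- A matrix `Z` supported on both adjacency sets is `c * lam` and also `lam * d`. So `(1 + c) *
  -- lam = lam * (1 + d)`, and `((1 + c)⁻¹, 1 + d)` fixes `lam`; inserting it adds `Z * y` to `lam *
  -- y`.
  obtain ⟨c, hc, hcZ⟩ := exists_mul_eq_of_supp_subset_adjL hlam hU fun i k h => (hZ i k h).1
  obtain ⟨d, hd, hdZ⟩ := exists_mul_eq_of_supp_subset_adjR hlam hU fun i k h => (hZ i k h).2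
  have hc' := one_add_mem_patternGroup hU hc
  refine ⟨x * (1 + c)⁻¹, mul_mem_patternGroup hU hUn hx (inv_mem_patternGroup hU hUn hc'),
    (1 + d) * y, mul_mem_patternGroup hU hUn (one_add_mem_patternGroup hU hd) hy, ?_, ?_⟩
  · have e : lam * (1 + d) = (1 + c) * lam := by rw [mul_add, add_mul, hcZ, hdZ]; simp
    calc _ = x * (1 + c)⁻¹ * (lam * (1 + d)) * y := by simp only [mul_assoc]
      _ = x * ((1 + c)⁻¹ * (1 + c)) * lam * y := by rw [e]; simp only [mul_assoc]
      _ = _ := by rw [inv_mul_of_mem_patternGroup hc', mul_one]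
  · intro i k hL hR
    rw [← hZ' i k ⟨hL, hR⟩, ← hdZ]
    refine congrFun (congrFun ?_ i) k
    noncomm_ring

/-- Elements of the stabilizer of `lam` whose right component lies in `U_P` make `x * lam - lam`
vanish on `adjL (upper n) lam ∩ adjR P lam`. -/
theorem exists_mul_mul_eq_vanish_left (hP : IsPoset P) (hn : IsNormal P)
    (hlam : lam ∈ labeledSetPartitions F P)
    {x y : Matrix (Fin n) (Fin n) F} (hx : x ∈ patternGroup F (upper n))
    (hy : y ∈ patternGroup F (upper n)) :
    ∃ x' ∈ patternGroup F (upper n), ∃ y' ∈ patternGroup F (upper n),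
      x' * lam * y' = x * lam * y ∧
      (∀ i k, (i, k) ∉ adjR P lam → (lam * y') i k = (lam * y) i k) ∧
      ∀ i k, (i, k) ∈ adjL (upper n) lam → (i, k) ∈ adjR P lam →
        (x' * lam - lam) i k = 0 := by
  have hU := isPoset_upper n
  have hUn := isNormal_upper n
  obtain ⟨Z, hZ, hZ'⟩ := exists_add_mul_eq_zero_on'
    (adjL (upper n) lam ∩ adjR P lam) hx (x * lam - lam)
  obtain ⟨c, hc, hcZ⟩ := exists_mul_eq_of_supp_subset_adjL hlam hU fun i k h => (hZ i k h).1
  obtain ⟨d, hd, hdZ⟩ := exists_mul_eq_of_supp_subset_adjR hlam hP fun i k h => (hZ i k h).2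
  have hd' := one_add_mem_patternGroup hP hd
  have hd'' := inv_mem_patternGroup hP hn hd'
  refine ⟨x * (1 + c), mul_mem_patternGroup hU hUn hx (one_add_mem_patternGroup hU hc),
    (1 + d)⁻¹ * y, mul_mem_patternGroup hU hUn (patternGroup_subset_upper hd'') hy, ?_, ?_, ?_⟩
  · have e : (1 + c) * lam = lam * (1 + d) := by rw [mul_add, add_mul, hcZ, hdZ]; simp
    calc _ = x * ((1 + c) * lam) * ((1 + d)⁻¹ * y) := by simp only [mul_assoc]
      _ = x * lam * ((1 + d) * (1 + d)⁻¹) * y := by rw [e]; simp only [mul_assoc]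
      _ = _ := by rw [mul_inv_of_mem_patternGroup hd', mul_one]
  -- The change in `lam * y` is `lam` times an element of the ideal `𝔫_P`, so it is confined to
  -- `adjR P lam`. This keeps zeros obtained earlier outside that set.
  · intro i k h
    by_contra h0
    refine h (mem_adjR_of_mul_ne_zero (N := ((1 + d)⁻¹ - 1) * y) hP
      (mul_mem_patternAlgebra_right hP hn ((mem_patternGroup hP).1 hd'')
        (blockTriangular_of_mem_patternGroup hy)) ?_)
    rw [sub_mul, one_mul, mul_sub, Matrix.sub_apply]
    exact sub_ne_zero.2 h0
  · intro i k hL hR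
    rw [← hZ' i k ⟨hL, hR⟩, ← hcZ]
    refine congrFun (congrFun ?_ i) k
    noncomm_ring

/-- Adding `N ∈ 𝔫_P` to `x` is left multiplication by `1 + N * x⁻¹ ∈ U_P`, and `N * lam` can be
prescribed freely on `adjL P lam`. -/
theorem exists_add_vanish_on_adjL (hP : IsPoset P) (hn : IsNormal P)
    (hlam : lam ∈ labeledSetPartitions F P)
    {x : Matrix (Fin n) (Fin n) F} (hx : x ∈ patternGroup F (upper n)) :
    ∃ x' ∈ patternGroup F (upper n), ∃ g ∈ patternGroup F P, x = g * x' ∧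
      (∀ i k, (i, k) ∈ adjL P lam → (x' * lam - lam) i k = 0) ∧
      ∀ i k, (i, k) ∉ adjL P lam → (x' * lam) i k = (x * lam) i k := by
  classical
  obtain ⟨N, hN, hNZ⟩ := exists_mul_eq_of_supp_subset_adjL hlam hP
    (Z := Matrix.of fun i k => if (i, k) ∈ adjL P lam then -(x * lam - lam) i k else 0)
    fun i k h => by
      by_contra h'
      simp [h'] at h
  have hg : 1 + N * x⁻¹ ∈ patternGroup F P := one_add_mem_patternGroup hP
    (mul_mem_patternAlgebra_right hP hn hN (blockTriangular_inv_of_mem_patternGroup hx))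
  have e : x + N = (1 + N * x⁻¹) * x := by
    rw [add_mul, one_mul, mul_assoc, inv_mul_of_mem_patternGroup hx, mul_one]
  refine ⟨x + N, ?_, (1 + N * x⁻¹)⁻¹, inv_mem_patternGroup hP hn hg, ?_, ?_, ?_⟩
  · rw [e]
    exact mul_mem_patternGroup (isPoset_upper n) (isNormal_upper n)
      (patternGroup_subset_upper hg) hx
  · rw [e, ← mul_assoc, inv_mul_of_mem_patternGroup hg, one_mul]
  · intro i k h
    rw [add_mul, hNZ]
    simp [h]
  · intro i k h
    rw [add_mul, hNZ]
    simp [h]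

theorem exists_add_vanish_on_adjR (hP : IsPoset P) (hn : IsNormal P)
    (hlam : lam ∈ labeledSetPartitions F P)
    {y : Matrix (Fin n) (Fin n) F} (hy : y ∈ patternGroup F (upper n)) :
    ∃ y' ∈ patternGroup F (upper n), ∃ g ∈ patternGroup F P, y = y' * g ∧
      (∀ i k, (i, k) ∈ adjR P lam → (lam * y' - lam) i k = 0) ∧
      ∀ i k, (i, k) ∉ adjR P lam → (lam * y') i k = (lam * y) i k := by
  classical
  obtain ⟨N, hN, hNZ⟩ := exists_mul_eq_of_supp_subset_adjR hlam hP
    (Z := Matrix.of fun i k => if (i, k) ∈ adjR P lam then -(lam * y - lam) i k else 0)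
    fun i k h => by
      by_contra h'
      simp [h'] at h
  have hg : 1 + y⁻¹ * N ∈ patternGroup F P := one_add_mem_patternGroup hP
    (mul_mem_patternAlgebra_left hP hn (blockTriangular_inv_of_mem_patternGroup hy) hN)
  have e : y + N = y * (1 + y⁻¹ * N) := by
    rw [mul_add, mul_one, ← mul_assoc, mul_inv_of_mem_patternGroup hy, one_mul]
  refine ⟨y + N, ?_, (1 + y⁻¹ * N)⁻¹, inv_mem_patternGroup hP hn hg, ?_, ?_, ?_⟩
  · rw [e]
    exact mul_mem_patternGroup (isPoset_upper n) (isNormal_upper n) hy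
      (patternGroup_subset_upper hg)
  · rw [e, mul_assoc, mul_inv_of_mem_patternGroup hg, mul_one]
  · intro i k h
    rw [mul_add, hNZ]
    simp [h]
  · intro i k h
    rw [mul_add, hNZ]
    simp [h]

/-- Every `U_P`-orbit in the `U_n`-orbit of `lam` contains some `lam + ℜ_lam(X)`. -/
theorem exists_mem_twoSidedOrbit_add_bigR (hP : IsPoset P) (hn : IsNormal P)
    (hlam : lam ∈ labeledSetPartitions F P)
    {x y : Matrix (Fin n) (Fin n) F} (hx : x ∈ patternGroup F (upper n))
    (hy : y ∈ patternGroup F (upper n)) :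
    ∃ X, supp X ⊆ aux P lam ∧ x * lam * y ∈ twoSidedOrbit P (lam + bigR P lam X) := by
  have hU := isPoset_upper n
  -- The order matters: each later adjustment changes `lam * y` only on `adjR P lam` and `x * lam`
  -- only on `adjL P lam` once the respective stabilizer correction is made, and these sets are
  -- cleared last.
  obtain ⟨x₁, hx₁, y₁, hy₁, e₁, h₁⟩ := exists_mul_mul_eq_vanish_right hlam hx hy
  obtain ⟨x₂, hx₂, y₂, hy₂, e₂, h₂, h₂'⟩ := exists_mul_mul_eq_vanish_left hP hn hlam hx₁ hy₁
  obtain ⟨x₃, hx₃, g, hg, rfl, h₃, h₃'⟩ := exists_add_vanish_on_adjL hP hn hlam hx₂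
  obtain ⟨y₃, hy₃, h, hh, rfl, h₄, h₄'⟩ := exists_add_vanish_on_adjR hP hn hlam hy₂
  set A := x₃ * lam - lam with hA
  set B := lam * y₃ - lam with hB
  have hA₁ (i k) (h0 : A i k ≠ 0) : (i, k) ∈ adjL (upper n) lam := by
    refine mem_adjL_of_mul_ne_zero (N := x₃ - 1) hU ((mem_patternGroup hU).1 hx₃) ?_
    rwa [sub_mul, one_mul]
  have hB₁ (i k) (h0 : B i k ≠ 0) : (i, k) ∈ adjR (upper n) lam := by
    refine mem_adjR_of_mul_ne_zero (N := y₃ - 1) hU ((mem_patternGroup hU).1 hy₃) ?_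
    rwa [mul_sub, mul_one]
  have hA₂ (i k) (h0 : A i k ≠ 0) : (i, k) ∉ adjL P lam := fun h' => h0 (h₃ i k h')
  have hB₂ (i k) (h0 : B i k ≠ 0) : (i, k) ∉ adjR P lam := fun h' => h0 (h₄ i k h')
  have hA₃ (i k) (h0 : A i k ≠ 0) : (i, k) ∉ adjR P lam := fun h' => h0 <| by
    rw [hA, Matrix.sub_apply, h₃' i k (hA₂ i k h0), ← Matrix.sub_apply]
    exact h₂' i k (hA₁ i k h0) h'
  have hB₃ (i k) (h0 : B i k ≠ 0) : (i, k) ∉ adjL (upper n) lam := fun h' => h0 <| by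
    rw [hB, Matrix.sub_apply, h₄' i k (hB₂ i k h0), h₂ i k (hB₂ i k h0), ← Matrix.sub_apply]
    exact h₁ i k h' (hB₁ i k h0)
  have hsupp : supp (A + B) ⊆ aux P lam := by
    rintro ⟨i, k⟩ h0
    by_cases hA0 : A i k = 0
    · have hB0 : B i k ≠ 0 := fun h' => h0 (by simp [hA0, h'])
      exact ⟨Or.inr (hB₁ i k hB0), fun h' => h'.elim
        (fun h' => hB₃ i k hB0 (adjL_subset_upper hP h')) (hB₂ i k hB0)⟩
    · exact ⟨Or.inl (hA₁ i k hA0), fun h' => h'.elim (hA₂ i k hA0) (hA₃ i k hA0)⟩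
  -- `B` avoids all of `adjL (upper n) lam`, hence `auxL P lam`, so `A` and `B` are the two
  -- components of `A + B`.
  obtain ⟨hAL, hBR⟩ := (part_unique P lam (A + B) hsupp A B).1 ⟨rfl,
    fun p h0 => ⟨hA₁ p.1 p.2 h0, hA₂ p.1 p.2 h0⟩,
    fun p h0 => ⟨⟨hB₁ p.1 p.2 h0, hB₂ p.1 p.2 h0⟩, fun h' => hB₃ p.1 p.2 h0 h'.1⟩⟩
  refine ⟨A + B, hsupp, g, hg, h, hh, ?_⟩
  rw [bigR, ← hAL, ← hBR, add_starProd_eq hlam hx₃ hy₃ (by simp [hA]) (by simp [hB]), ← e₁, ← e₂]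
  simp only [mul_assoc]

/-- `lam + ℜ_lam(X)` lies in the two-sided `U_n`-orbit of `lam`. -/
theorem exists_add_bigR_eq (hlam : lam ∈ labeledSetPartitions F P)
    {X : Matrix (Fin n) (Fin n) F} (hX : supp X ⊆ aux P lam) :
    ∃ x ∈ patternGroup F (upper n), ∃ y ∈ patternGroup F (upper n),
      lam + bigR P lam X = x * lam * y := by
  have hU := isPoset_upper n
  obtain ⟨-, hL, hR⟩ := (part_unique P lam X hX _ _).2 ⟨rfl, rfl⟩
  obtain ⟨a, ha, haL⟩ := exists_mul_eq_of_supp_subset_adjL hlam hU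
    fun i k (h : partL P lam X i k ≠ 0) => (hL h).1
  obtain ⟨b, hb, hbR⟩ := exists_mul_eq_of_supp_subset_adjR hlam hU
    fun i k (h : partRL P lam X i k ≠ 0) => (hR h).1.1
  have ha' := one_add_mem_patternGroup hU ha
  have hb' := one_add_mem_patternGroup hU hb
  refine ⟨1 + a, ha', 1 + b, hb', add_starProd_eq hlam ha' hb' ?_ ?_⟩
  · rw [add_mul, one_mul, haL]
  · rw [mul_add, mul_one, hbR]

/-! ### Elimination to a labeled set partition -/

/-- Row operations clear the row `r` in all columns with a pivot below it. -/
theorem exists_mul_clear_row (r : Fin n) {N : Matrix (Fin n) (Fin n) F}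
    (hrow : ∀ i j k, r < i → N i j ≠ 0 → N i k ≠ 0 → j = k)
    (hcol : ∀ i j k, r < i → r < j → N i k ≠ 0 → N j k ≠ 0 → i = j) :
    ∃ x ∈ patternGroup F (upper n), (∀ i k, i ≠ r → (x * N) i k = N i k) ∧
      ∀ j k, r < j → N j k ≠ 0 → (x * N) r k = 0 := by
  have hU := isPoset_upper n
  -- As `0⁻¹ = 0`, the sum picks out the pivot of row `j`.
  let A : Matrix (Fin n) (Fin n) F :=
    Matrix.of fun i j => if i = r ∧ r < j then -∑ k, N r k * (N j k)⁻¹ else 0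
  have hA (i j) : A i j = if i = r ∧ r < j then -∑ k, N r k * (N j k)⁻¹ else 0 := rfl
  refine ⟨1 + A, one_add_mem_patternGroup hU ?_, ?_, ?_⟩
  · rw [mem_patternAlgebra hU]
    intro i j h
    rw [hA] at h
    split_ifs at h with h'
    · exact h'.1 ▸ h'.2
    · exact absurd rfl h
  · intro i k hi
    rw [add_mul, one_mul, Matrix.add_apply, Matrix.mul_apply, Finset.sum_eq_zero, add_zero]
    intro j _
    rw [hA, if_neg fun h => hi h.1, zero_mul]
  · intro j k hj hjk
    rw [add_mul, one_mul, Matrix.add_apply, Matrix.mul_apply, Finset.sum_eq_single j, hA,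
      if_pos ⟨rfl, hj⟩, Finset.sum_eq_single k, neg_mul, mul_assoc, inv_mul_cancel₀ hjk, mul_one,
      add_neg_cancel]
    · intro k' _ hk'
      by_contra h0
      exact hk' (hrow j k' k hj (inv_eq_zero.not.1 (right_ne_zero_of_mul h0)) hjk)
    · simp
    · intro j' _ hj'
      by_contra h0
      have h1 := left_ne_zero_of_mul h0
      rw [hA] at h1
      split_ifs at h1 with h2
      · exact hj' (hcol j' j k h2.2 hj (right_ne_zero_of_mul h0) hjk)
      · exact h1 rfl
    · simp

/-- Column operations leave at most one nonzero entry in row `r`. -/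
theorem exists_mul_clear_row_right (r : Fin n) {N : Matrix (Fin n) (Fin n) F}
    (hr : ∀ j k, r < j → N j k ≠ 0 → N r k = 0) :
    ∃ y ∈ patternGroup F (upper n), (∀ i k, r < i → (N * y) i k = N i k) ∧
      (∀ k, (N * y) r k ≠ 0 → N r k ≠ 0) ∧
      ∀ j k, (N * y) r j ≠ 0 → (N * y) r k ≠ 0 → j = k := by
  classical
  have hU := isPoset_upper n
  by_cases hN : ∃ k, N r k ≠ 0
  swap
  · push Not at hN
    exact ⟨1, one_mem_patternGroup hU, by simp, by simp, by simp [hN]⟩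
  -- The leftmost nonzero entry is the pivot: upper triangular column operations only add a column
  -- to columns on its right. By `hr`, column `k` vanishes below row `r`, so the lower rows are
  -- untouched.
  obtain ⟨k, hk, hmin⟩ : ∃ k, N r k ≠ 0 ∧ ∀ l, l < k → N r l = 0 := by
    obtain ⟨k, hk, hmin⟩ := WellFounded.has_min (wellFounded_lt (α := Fin n))
      {k | N r k ≠ 0} hN
    exact ⟨k, hk, fun l hl => by_contra fun h => hmin l h hl⟩
  let B : Matrix (Fin n) (Fin n) F :=
    Matrix.of fun i l => if i = k ∧ k < l then -(N r k)⁻¹ * N r l else 0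
  have hB (i l) : B i l = if i = k ∧ k < l then -(N r k)⁻¹ * N r l else 0 := rfl
  have hNB (i l) : (N * (1 + B)) i l = N i l + N i k * B k l := by
    rw [mul_add, mul_one, Matrix.add_apply, Matrix.mul_apply, Finset.sum_eq_single k]
    · intro j _ hj
      rw [hB, if_neg fun h => hj h.1, mul_zero]
    · simp
  have hrk (l) (hl : (N * (1 + B)) r l ≠ 0) : l = k := by
    by_contra h
    apply hl
    rw [hNB, hB]
    rcases lt_or_gt_of_ne h with h | h
    · rw [hmin l h, if_neg fun h' => lt_asymm h h'.2]
      simp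
    · rw [if_pos ⟨rfl, h⟩]
      field_simp
      simp
  refine ⟨1 + B, one_add_mem_patternGroup hU ?_, ?_, ?_, ?_⟩
  · rw [mem_patternAlgebra hU]
    intro i l h
    rw [hB] at h
    split_ifs at h with h'
    · exact h'.1 ▸ h'.2
    · exact absurd rfl h
  · intro i l hi
    have : N i k = 0 := by
      by_contra h
      exact hk (hr i k hi h)
    rw [hNB, this, zero_mul, add_zero]
  · intro l hl
    rw [hrk l hl]
    exact hk
  · intro j l hj hl
    rw [hrk j hj, hrk l hl]

/-- Every matrix in `𝔫_P` is in the two-sided `U_n`-orbit of a labeled set partition. -/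
theorem exists_mem_labeledSetPartitions (hP : IsPoset P) (hn : IsNormal P)
    {M : Matrix (Fin n) (Fin n) F} (hM : M ∈ patternAlgebra F P) :
    ∃ mu ∈ labeledSetPartitions F P, ∃ x ∈ patternGroup F (upper n),
      ∃ y ∈ patternGroup F (upper n), M = x * mu * y := by
  have hU := isPoset_upper n
  have hUn := isNormal_upper n
  -- Induction on the number `m` of bottom rows that already have the required shape.
  have main (m : ℕ) : m ≤ n → ∃ x ∈ patternGroup F (upper n), ∃ y ∈ patternGroup F (upper n),
      (∀ i j k : Fin n, n ≤ i + m → (x * M * y) i j ≠ 0 → (x * M * y) i k ≠ 0 → j = k) ∧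
      ∀ i j k : Fin n, n ≤ i + m → n ≤ j + m → (x * M * y) i k ≠ 0 → (x * M * y) j k ≠ 0 →
        i = j := by
    induction m with
    | zero =>
      exact fun _ => ⟨1, one_mem_patternGroup hU, 1, one_mem_patternGroup hU,
        fun i j k h => by omega, fun i j k h => by omega⟩
    | succ m ih =>
      intro hm
      obtain ⟨x, hx, y, hy, hrow, hcol⟩ := ih (by omega)
      let r : Fin n := ⟨n - (m + 1), by omega⟩
      have hr (i : Fin n) (h : n ≤ i + (m + 1)) : i = r ∨ r < i := by
        have : (r : ℕ) = n - (m + 1) := rfl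
        rw [Fin.ext_iff, Fin.lt_def]
        omega
      have hr' (i : Fin n) (h : r < i) : n ≤ i + m := by
        have : (r : ℕ) = n - (m + 1) := rfl
        rw [Fin.lt_def] at h
        omega
      obtain ⟨x', hx', h1, h2⟩ := exists_mul_clear_row r
        (fun i j k h => hrow i j k (hr' i h)) (fun i j k h h' => hcol i j k (hr' i h) (hr' j h'))
      obtain ⟨y', hy', h3, h4, h5⟩ := exists_mul_clear_row_right r (N := x' * (x * M * y))
        fun j k hj hjk => h2 j k hj (by rwa [h1 j k hj.ne'] at hjk)
      have e : x' * x * M * (y * y') = x' * (x * M * y) * y' := by simp only [mul_assoc]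
      have h6 (i k) (hi : r < i) : (x' * (x * M * y) * y') i k = (x * M * y) i k := by
        rw [h3 i k hi, h1 i k hi.ne']
      refine ⟨x' * x, mul_mem_patternGroup hU hUn hx' hx, y * y',
        mul_mem_patternGroup hU hUn hy hy', ?_, ?_⟩
      · intro i j k hi
        rw [e]
        rcases hr i hi with rfl | hi
        · exact h5 j k
        · rw [h6 i j hi, h6 i k hi]
          exact hrow i j k (hr' i hi)
      · intro i j k hi hj
        rw [e]
        rcases hr i hi with rfl | hi <;> rcases hr j hj with rfl | hj
        · exact fun _ _ => rfl
        · rw [h6 j k hj]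
          exact fun h h' => absurd (h2 j k hj h') (h4 k h)
        · rw [h6 i k hi]
          exact fun h' h => absurd (h2 i k hi h') (h4 k h)
        · rw [h6 i k hi, h6 j k hj]
          exact hcol i j k (hr' i hi) (hr' j hj)
  obtain ⟨x, hx, y, hy, hrow, hcol⟩ := main n le_rfl
  refine ⟨x * M * y, ⟨?_, fun i j k => hrow i j k (by omega),
    fun i j k => hcol i j k (by omega) (by omega)⟩, x⁻¹, inv_mem_patternGroup hU hUn hx, y⁻¹,
    inv_mem_patternGroup hU hUn hy, ?_⟩
  · exact mul_mem_patternAlgebra_right hP hn (mul_mem_patternAlgebra_left hP hn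
      (blockTriangular_of_mem_patternGroup hx) hM) (blockTriangular_of_mem_patternGroup hy)
  · calc M = (x⁻¹ * x) * M * (y * y⁻¹) := by
          rw [inv_mul_of_mem_patternGroup hx, mul_inv_of_mem_patternGroup hy]; simp
      _ = _ := by simp only [mul_assoc]

/-! ### Orbit sizes and the counting argument -/

theorem card_eq_card_image_mul {α β : Type*} [DecidableEq β] {s : Finset α} {f : α → β} {c : ℕ}
    (h : ∀ a ∈ s, (s.filter fun a' => f a' = f a).card = c) :
    s.card = (s.image f).card * c := by
  rw [Finset.card_eq_sum_card_image f s]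
  refine Finset.sum_const_nat fun b hb => ?_
  obtain ⟨a, ha, rfl⟩ := Finset.mem_image.1 hb
  exact h a ha

theorem ncard_supp_subset [Fintype F] (S : Set (Fin n × Fin n)) :
    {X : Matrix (Fin n) (Fin n) F | supp X ⊆ S}.ncard = Fintype.card F ^ S.ncard := by
  classical
  let e : {X : Matrix (Fin n) (Fin n) F | supp X ⊆ S} ≃ (S → F) :=
    { toFun := fun X p => X.1 p.1.1 p.1.2
      invFun := fun f => ⟨Matrix.of fun i j => if h : (i, j) ∈ S then f ⟨(i, j), h⟩ else 0, by
        intro p hp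
        by_contra h
        exact hp (by simp [h])⟩
      left_inv := by
        intro X
        ext i j
        by_cases h : (i, j) ∈ S
        · simp [h]
        · have : X.1 i j = 0 := by
            by_contra h'
            exact h (X.2 h')
          simp [h, this]
      right_inv := by
        intro f
        ext p
        simp }
  rw [← Nat.card_coe_set_eq, Nat.card_congr e, Nat.card_fun, Nat.card_eq_fintype_card,
    Nat.card_coe_set_eq]

theorem exists_sub_eq_of_supp_subset_adj (hP : IsPoset P)
    (hlam : lam ∈ labeledSetPartitions F P) {X : Matrix (Fin n) (Fin n) F}
    (hX : supp X ⊆ adj P lam) :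
    ∃ a ∈ patternAlgebra F P, ∃ b ∈ patternAlgebra F P, a * lam - lam * b = X := by
  classical
  obtain ⟨a, ha, haX⟩ := exists_mul_eq_of_supp_subset_adjL hlam hP
    (Z := restrict (adjL P lam) X) fun i k h => by
      by_contra h'
      exact h (by simp [restrict, h'])
  obtain ⟨b, hb, hbX⟩ := exists_mul_eq_of_supp_subset_adjR hlam hP
    (Z := restrict (adjL P lam) X - X) fun i k h => by
      by_cases hL : (i, k) ∈ adjL P lam
      · exact absurd (by simp [restrict, hL]) h
      · exact (hX (show X i k ≠ 0 by simpa [restrict, hL] using h)).resolve_left hL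
  exact ⟨a, ha, b, hb, by rw [haX, hbX, sub_sub_cancel]⟩

/-- The linear map `φ` and the orbit map `ψ` on `𝔫_P × 𝔫_P` have fibres of the same size, because
`(1 + a) * lam = lam * (1 + b)` is equivalent to `a * lam = lam * b`. So their images, the matrices
supported on `adj P lam` and the orbit, are equinumerous. -/
theorem ncard_twoSidedOrbit [Fintype F] (hP : IsPoset P) (hn : IsNormal P)
    (hlam : lam ∈ labeledSetPartitions F P) :
    (twoSidedOrbit P lam).ncard = Fintype.card F ^ (adj P lam).ncard := by
  classical
  let s : Finset (Matrix (Fin n) (Fin n) F × Matrix (Fin n) (Fin n) F) :=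
    Finset.univ.filter fun p => p.1 ∈ patternAlgebra F P ∧ p.2 ∈ patternAlgebra F P
  let K := s.filter fun p => p.1 * lam = lam * p.2
  let φ : Matrix (Fin n) (Fin n) F × Matrix (Fin n) (Fin n) F → Matrix (Fin n) (Fin n) F :=
    fun p => p.1 * lam - lam * p.2
  let ψ : Matrix (Fin n) (Fin n) F × Matrix (Fin n) (Fin n) F → Matrix (Fin n) (Fin n) F :=
    fun p => (1 + p.1) * lam * (1 + p.2)⁻¹
  have hs (p) : p ∈ s ↔ p.1 ∈ patternAlgebra F P ∧ p.2 ∈ patternAlgebra F P := by simp [s]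
  have hsub {X Y : Matrix (Fin n) (Fin n) F} (hX : X ∈ patternAlgebra F P)
      (hY : Y ∈ patternAlgebra F P) : X - Y ∈ patternAlgebra F P := by
    rw [sub_eq_add_neg]
    exact add_mem_patternAlgebra hP hX (neg_mem_patternAlgebra hP hY)
  have hφ : s.card = (s.image φ).card * K.card := by
    refine card_eq_card_image_mul fun p hp => ?_
    rw [hs] at hp
    refine Finset.card_nbij' (fun p' => p' - p) (fun p' => p' + p) ?_ ?_
      (fun p' _ => sub_add_cancel p' p) (fun p' _ => add_sub_cancel_right p' p)
    · intro p' hp'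
      rw [Finset.mem_coe, Finset.mem_filter, hs] at hp' ⊢
      refine ⟨⟨hsub hp'.1.1 hp.1, hsub hp'.1.2 hp.2⟩, ?_⟩
      have h := sub_eq_zero.2 hp'.2
      rw [← sub_eq_zero, ← h]
      simp only [φ, Prod.fst_sub, Prod.snd_sub]
      noncomm_ring
    · intro p' hp'
      rw [Finset.mem_coe, Finset.mem_filter, hs] at hp' ⊢
      refine ⟨⟨add_mem_patternAlgebra hP hp'.1.1 hp.1,
        add_mem_patternAlgebra hP hp'.1.2 hp.2⟩, ?_⟩
      have h := sub_eq_zero.2 hp'.2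
      rw [← sub_eq_zero, ← h]
      simp only [φ, Prod.fst_add, Prod.snd_add]
      noncomm_ring
  have hψ : s.card = (s.image ψ).card * K.card := by
    refine card_eq_card_image_mul fun p hp => ?_
    rw [hs] at hp
    have hg := one_add_mem_patternGroup hP hp.1
    have hh := one_add_mem_patternGroup hP hp.2
    have hmem {u v : Matrix (Fin n) (Fin n) F} (hu : u ∈ patternGroup F P)
        (hv : v ∈ patternAlgebra F P) : u * (1 + v) - 1 ∈ patternAlgebra F P :=
      (mem_patternGroup hP).1 (mul_mem_patternGroup hP hn hu (one_add_mem_patternGroup hP hv))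
    -- The fibre of `ψ` through `p` is a multiplicative coset of the stabilizer, which is `K`
    -- shifted by `1` in each component.
    refine Finset.card_nbij'
      (fun p' => ((1 + p.1)⁻¹ * (1 + p'.1) - 1, (1 + p.2)⁻¹ * (1 + p'.2) - 1))
      (fun p' => ((1 + p.1) * (1 + p'.1) - 1, (1 + p.2) * (1 + p'.2) - 1)) ?_ ?_ ?_ ?_
    · intro p' hp'
      rw [Finset.mem_coe, Finset.mem_filter, hs] at hp' ⊢
      refine ⟨⟨hmem (inv_mem_patternGroup hP hn hg) hp'.1.1,
        hmem (inv_mem_patternGroup hP hn hh) hp'.1.2⟩, ?_⟩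
      have h : (1 + p'.1) * lam * (1 + p'.2)⁻¹ = (1 + p.1) * lam * (1 + p.2)⁻¹ := hp'.2
      have hh' := one_add_mem_patternGroup hP hp'.1.2
      rw [sub_mul, mul_sub, one_mul, mul_one, sub_left_inj]
      calc _ = (1 + p.1)⁻¹ * ((1 + p'.1) * lam * ((1 + p'.2)⁻¹ * (1 + p'.2))) := by
            rw [inv_mul_of_mem_patternGroup hh', mul_one, mul_assoc]
        _ = (1 + p.1)⁻¹ * ((1 + p'.1) * lam * (1 + p'.2)⁻¹) * (1 + p'.2) := by
            simp only [mul_assoc]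
        _ = ((1 + p.1)⁻¹ * (1 + p.1)) * lam * (1 + p.2)⁻¹ * (1 + p'.2) := by
            rw [h]; simp only [mul_assoc]
        _ = _ := by rw [inv_mul_of_mem_patternGroup hg, one_mul, mul_assoc]
    · intro p' hp'
      rw [Finset.mem_coe, Finset.mem_filter, hs] at hp' ⊢
      refine ⟨⟨hmem hg hp'.1.1, hmem hh hp'.1.2⟩, ?_⟩
      have hh' := one_add_mem_patternGroup hP hp'.1.2
      have h : (1 + p'.1) * lam = lam * (1 + p'.2) := by
        rw [add_mul, mul_add, hp'.2, one_mul, mul_one]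
      simp only [ψ, add_sub_cancel]
      rw [Matrix.mul_inv_rev]
      calc _ = (1 + p.1) * ((1 + p'.1) * lam) * (1 + p'.2)⁻¹ * (1 + p.2)⁻¹ := by
            simp only [mul_assoc]
        _ = (1 + p.1) * lam * ((1 + p'.2) * (1 + p'.2)⁻¹) * (1 + p.2)⁻¹ := by
            rw [h]; simp only [mul_assoc]
        _ = _ := by rw [mul_inv_of_mem_patternGroup hh', mul_one]
    · intro p' _
      ext1
      · simp only [add_sub_cancel]
        rw [← mul_assoc, mul_inv_of_mem_patternGroup hg, one_mul, add_sub_cancel_left]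
      · simp only [add_sub_cancel]
        rw [← mul_assoc, mul_inv_of_mem_patternGroup hh, one_mul, add_sub_cancel_left]
    · intro p' _
      ext1
      · simp only [add_sub_cancel]
        rw [← mul_assoc, inv_mul_of_mem_patternGroup hg, one_mul, add_sub_cancel_left]
      · simp only [add_sub_cancel]
        rw [← mul_assoc, inv_mul_of_mem_patternGroup hh, one_mul, add_sub_cancel_left]
  have hKpos : 0 < K.card := Finset.card_pos.2 ⟨0, by
    have h0 : (0 : Matrix (Fin n) (Fin n) F) ∈ patternAlgebra F P := by
      simpa using hsub hlam.1 hlam.1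
    rw [Finset.mem_filter, hs]
    exact ⟨⟨h0, h0⟩, by simp⟩⟩
  have hφim : ((s.image φ : Finset _) : Set (Matrix (Fin n) (Fin n) F)) =
      {X | supp X ⊆ adj P lam} := by
    ext X
    rw [Finset.mem_coe, Finset.mem_image, Set.mem_ofPred_eq]
    constructor
    · rintro ⟨p, hp, rfl⟩ ⟨i, k⟩ h
      rw [hs] at hp
      by_cases h0 : (p.1 * lam) i k = 0
      · refine Or.inr (mem_adjR_of_mul_ne_zero hP hp.2 fun h1 => h ?_)
        simp only [φ, Matrix.sub_apply, h0, h1, sub_zero]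
      · exact Or.inl (mem_adjL_of_mul_ne_zero hP hp.1 h0)
    · intro hX
      obtain ⟨a, ha, b, hb, h⟩ := exists_sub_eq_of_supp_subset_adj hP hlam hX
      exact ⟨(a, b), (hs _).2 ⟨ha, hb⟩, h⟩
  have hψim : ((s.image ψ : Finset _) : Set (Matrix (Fin n) (Fin n) F)) =
      twoSidedOrbit P lam := by
    ext X
    rw [Finset.mem_coe, Finset.mem_image]
    constructor
    · rintro ⟨p, hp, rfl⟩
      rw [hs] at hp
      exact ⟨_, one_add_mem_patternGroup hP hp.1, _,
        inv_mem_patternGroup hP hn (one_add_mem_patternGroup hP hp.2), rfl⟩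
    · rintro ⟨x, hx, y, hy, rfl⟩
      refine ⟨(x - 1, y⁻¹ - 1), (hs _).2 ⟨(mem_patternGroup hP).1 hx,
        (mem_patternGroup hP).1 (inv_mem_patternGroup hP hn hy)⟩, ?_⟩
      simp only [ψ, add_sub_cancel]
      rw [Matrix.nonsing_inv_nonsing_inv _ (isUnit_det_of_mem_patternGroup hy)]
  rw [← hψim, ← ncard_supp_subset, ← hφim, Set.ncard_coe_finset, Set.ncard_coe_finset]
  exact Nat.eq_of_mul_eq_mul_right hKpos (hψ.symm.trans hφ)

theorem ncard_twoSidedOrbit_add_bigR [Fintype F] (hP : IsPoset P) (hn : IsNormal P)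
    (hlam : lam ∈ labeledSetPartitions F P) {X : Matrix (Fin n) (Fin n) F}
    (hX : supp X ⊆ aux P lam) :
    (twoSidedOrbit P (lam + bigR P lam X)).ncard = Fintype.card F ^ (adj P lam).ncard := by
  obtain ⟨x, hx, y, hy, h⟩ := exists_add_bigR_eq hlam hX
  rw [h, twoSidedOrbit_mul_mul hP hn hx hy, Set.ncard_image_of_injective,
    ncard_twoSidedOrbit hP hn hlam]
  refine Function.LeftInverse.injective (g := fun Z => x⁻¹ * Z * y⁻¹) fun Z => ?_
  calc _ = (x⁻¹ * x) * Z * (y * y⁻¹) := by simp only [mul_assoc]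
    _ = Z := by rw [inv_mul_of_mem_patternGroup hx, mul_inv_of_mem_patternGroup hy]; simp

/-- Pigeonhole: if `X ≠ Y` gave the same orbit, the orbits of the matrices other than `Y` would
cover the whole `U_n`-orbit, which is too large for that since `|adj_[[n]]| = |aux_P| + |adj_P|`. -/
theorem eq_of_twoSidedOrbit_add_bigR_eq [Fintype F] (hP : IsPoset P) (hn : IsNormal P)
    (hlam : lam ∈ labeledSetPartitions F P) {X Y : Matrix (Fin n) (Fin n) F}
    (hX : supp X ⊆ aux P lam) (hY : supp Y ⊆ aux P lam)
    (h : twoSidedOrbit P (lam + bigR P lam X) = twoSidedOrbit P (lam + bigR P lam Y)) :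
    X = Y := by
  classical
  by_contra hXY
  have hlam' : lam ∈ labeledSetPartitions F (upper n) :=
    ⟨patternAlgebra_subset_upper hlam.1, hlam.2⟩
  let T := {Z : Matrix (Fin n) (Fin n) F | supp Z ⊆ aux P lam}.toFinset
  let orb (Z : Matrix (Fin n) (Fin n) F) := (twoSidedOrbit P (lam + bigR P lam Z)).toFinset
  have hT : T.card = Fintype.card F ^ (aux P lam).ncard := by
    rw [← ncard_supp_subset, Set.ncard_eq_toFinset_card']
  have hcover : (twoSidedOrbit (upper n) lam).toFinset ⊆ (T.erase Y).biUnion orb := by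
    intro Z hZ
    rw [Set.mem_toFinset] at hZ
    obtain ⟨x, hx, y, hy, rfl⟩ := hZ
    obtain ⟨W, hW, hmem⟩ := exists_mem_twoSidedOrbit_add_bigR hP hn hlam hx hy
    rw [Finset.mem_biUnion]
    by_cases hWY : W = Y
    · exact ⟨X, Finset.mem_erase.2 ⟨hXY, Set.mem_toFinset.2 hX⟩,
        Set.mem_toFinset.2 (by rwa [h, ← hWY])⟩
    · exact ⟨W, Finset.mem_erase.2 ⟨hWY, Set.mem_toFinset.2 hW⟩, Set.mem_toFinset.2 hmem⟩
  have h1 := Finset.card_le_card hcover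
  have h2 := Finset.card_biUnion_le_card_mul (T.erase Y) orb
    (Fintype.card F ^ (adj P lam).ncard) fun Z hZ => by
      rw [← Set.ncard_eq_toFinset_card', ncard_twoSidedOrbit_add_bigR hP hn hlam
        (Set.mem_toFinset.1 (Finset.mem_of_mem_erase hZ))]
  have hsub : adj P lam ⊆ adj (upper n) lam :=
    Set.union_subset_union (adjL_subset_upper hP) (adjR_subset_upper hP)
  rw [← Set.ncard_eq_toFinset_card', ncard_twoSidedOrbit (isPoset_upper n) (isNormal_upper n)
    hlam', ← Set.ncard_sdiff_add_ncard_of_subset hsub, pow_add] at h1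
  have hpos : 0 < Fintype.card F ^ (adj P lam).ncard := pow_pos Fintype.card_pos _
  have h3 := Nat.le_of_mul_le_mul_right (h1.trans h2) hpos
  have h4 := Finset.card_erase_lt_of_mem (s := T) (a := Y) (Set.mem_toFinset.2 hY)
  rw [hT] at h4
  exact absurd h3 (not_le.2 h4)

/-! ### From orbits to superclasses -/

theorem superclassOf_rep (P : Set (Fin n × Fin n)) (lam X : Matrix (Fin n) (Fin n) F) :
    superclassOf P (rep P lam X) =
      (fun Y => 1 + Y) '' twoSidedOrbit P (lam + bigR P lam X) := by
  rw [superclassOf_eq_image, rep, add_assoc, add_sub_cancel_left]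

theorem add_bigR_mem_patternAlgebra (hP : IsPoset P) (hn : IsNormal P)
    (hlam : lam ∈ labeledSetPartitions F P) {X : Matrix (Fin n) (Fin n) F}
    (hX : supp X ⊆ aux P lam) : lam + bigR P lam X ∈ patternAlgebra F P := by
  obtain ⟨x, hx, y, hy, h⟩ := exists_add_bigR_eq hlam hX
  rw [h]
  exact mul_mem_patternAlgebra_right hP hn (mul_mem_patternAlgebra_left hP hn
    (blockTriangular_of_mem_patternGroup hx) hlam.1) (blockTriangular_of_mem_patternGroup hy)

/-- A common `U_P`-orbit puts `lam` and `mu` in the same `U_n`-orbit. -/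
theorem fst_eq_of_twoSidedOrbit_add_bigR_eq (hP : IsPoset P)
    {mu : Matrix (Fin n) (Fin n) F} (hlam : lam ∈ labeledSetPartitions F P)
    (hmu : mu ∈ labeledSetPartitions F P) {X Y : Matrix (Fin n) (Fin n) F}
    (hX : supp X ⊆ aux P lam) (hY : supp Y ⊆ aux P mu)
    (h : twoSidedOrbit P (lam + bigR P lam X) = twoSidedOrbit P (mu + bigR P mu Y)) :
    lam = mu := by
  have hU := isPoset_upper n
  have hUn := isNormal_upper n
  obtain ⟨x, hx, y, hy, h₁⟩ := exists_add_bigR_eq hlam hX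
  obtain ⟨u, hu, v, hv, h₂⟩ := exists_add_bigR_eq hmu hY
  have hmem := mem_twoSidedOrbit_self hP (lam + bigR P lam X)
  rw [h] at hmem
  obtain ⟨g, hg, k, hk, h₃⟩ := hmem
  rw [h₁, h₂] at h₃
  refine eq_of_mul_eq_mul hlam hmu (x := x⁻¹ * g * u) (y := y * k⁻¹ * v⁻¹) ?_ ?_ ?_
  · exact mul_mem_patternGroup hU hUn (mul_mem_patternGroup hU hUn
      (inv_mem_patternGroup hU hUn hx) (patternGroup_subset_upper hg)) hu
  · exact mul_mem_patternGroup hU hUn (mul_mem_patternGroup hU hUn hy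
      (inv_mem_patternGroup hU hUn (patternGroup_subset_upper hk)))
      (inv_mem_patternGroup hU hUn hv)
  · calc lam * (y * k⁻¹ * v⁻¹) = (x⁻¹ * x) * lam * y * k⁻¹ * v⁻¹ := by
          rw [inv_mul_of_mem_patternGroup hx]; simp only [mul_assoc, one_mul]
      _ = x⁻¹ * (x * lam * y) * k⁻¹ * v⁻¹ := by simp only [mul_assoc]
      _ = x⁻¹ * g * u * mu * v * (k * k⁻¹) * v⁻¹ := by rw [h₃]; simp only [mul_assoc]
      _ = x⁻¹ * g * u * mu * (v * v⁻¹) := by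
          rw [mul_inv_of_mem_patternGroup hk]; simp only [mul_assoc, one_mul]
      _ = _ := by rw [mul_inv_of_mem_patternGroup hv, mul_one]

end PatternGroup


theorem mainTheorem2 {F : Type*} [Field F] [Fintype F] (n : ℕ) (P : Set (Fin n × Fin n))
    (hP : PatternGroup.IsPoset P) (hnormal : PatternGroup.IsNormal P) :
    (∀ p ∈ PatternGroup.indexSet F P,
      PatternGroup.rep P p.1 p.2 ∈ PatternGroup.patternGroup F P) ∧
    Set.BijOn (fun p => PatternGroup.superclassOf P (PatternGroup.rep P p.1 p.2))
      (PatternGroup.indexSet F P) (PatternGroup.superclasses F P) ∧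
    (∀ p ∈ PatternGroup.indexSet F P,
      (PatternGroup.superclassOf P (PatternGroup.rep P p.1 p.2)).ncard =
        Fintype.card F ^ (PatternGroup.adj P p.1).ncard) := by
  open PatternGroup in
  refine ⟨?_, ⟨?_, ?_, ?_⟩, ?_⟩
  · rintro ⟨lam, X⟩ ⟨hlam, -, hX⟩
    rw [rep, add_assoc]
    exact one_add_mem_patternGroup hP (add_bigR_mem_patternAlgebra hP hnormal hlam hX)
  · rintro ⟨lam, X⟩ ⟨hlam, -, hX⟩
    exact ⟨_, add_bigR_mem_patternAlgebra hP hnormal hlam hX, superclassOf_rep P lam X⟩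
  · rintro ⟨lam, X⟩ ⟨hlam, -, hX⟩ ⟨mu, Y⟩ ⟨hmu, -, hY⟩ h
    simp only [superclassOf_rep] at h hlam hmu hX hY
    have h' := Set.image_injective.2 (add_right_injective 1) h
    obtain rfl := fst_eq_of_twoSidedOrbit_add_bigR_eq hP hlam hmu hX hY h'
    rw [eq_of_twoSidedOrbit_add_bigR_eq hP hnormal hlam hX hY h']
  · rintro _ ⟨M, hM, rfl⟩
    obtain ⟨lam, hlam, x, hx, y, hy, rfl⟩ := exists_mem_labeledSetPartitions hP hnormal hM
    obtain ⟨X, hX, h⟩ := exists_mem_twoSidedOrbit_add_bigR hP hnormal hlam hx hy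
    refine ⟨(lam, X), ⟨hlam, (mem_patternAlgebra hP).2 fun i j hij =>
      adj_upper_subset hP hnormal hlam (hX hij).1, hX⟩, ?_⟩
    simp only [superclassOf_rep]
    rw [twoSidedOrbit_eq_of_mem hP hnormal h]
  · rintro ⟨lam, X⟩ ⟨hlam, -, hX⟩
    rw [superclassOf_rep, Set.ncard_image_of_injective _ (add_right_injective 1)]
    exact ncard_twoSidedOrbit_add_bigR hP hnormal hlam hX
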